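/- Let $J$ be a finite set of jobs, where job $j$ has a processing time $p_j>0$ and a release date $r_j\ge 0$, and let $\alpha\in[0,1)$. A (feasible, preemptive) schedule on a single machine of unit speed processes, at each time, jobs that have already been released at nonnegative rates of total at most $1$, and processes every job $j$ for exactly $p_j$ units in total. For a given schedule, $y_j(t)$ denotes the amount of processing that $j$ has received until time $t$, $p_j(t)=p_j-y_j(t)$ its remaining processing time, $C_j$ its completion time, and $\{j : r_j\le t<C_j\}$ is the set of jobs alive at time $t$. The signal time $s_j$ is the earliest time from $r_j$ on at which $y_j=\alpha p_j$. Consider a schedule of the following algorithm. Let $A(t)$ be the set of jobs alive at time $t$ in it, and put $N(t)=\{j\in A(t): y_j(t)\le \alpha p_j\}$ and $C(t)=\{j\in A(t): y_j(t)>\alpha p_j\}$; if $\alpha=0$, all jobs are known at arrival and we put instead $N(t)=\emptyset$ and $C(t)=A(t)$. At every time $t$ (with $\min\emptyset=\infty$): 1. if $C(t)\neq\emptyset$ and $\min_{j\in C(t)}p_j(t)\le \frac{1-\alpha}{\alpha}\min_{j\in N(t)}y_j(t)$ (a condition that always holds if $N(t)=\emptyset$), the algorithm processes at rate $1$ a job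 of $C(t)$ with smallest remaining processing time, choosing among several such jobs one with maximum $s_j$ and breaking remaining ties arbitrarily; 2. otherwise it processes all jobs of $N(t)$ with the smallest $y_j(t)$ at equal rates of total $1$ (and idles if $N(t)=\emptyset$). Fix any schedule of the same instance that minimizes the total flow time $\sum_j (C_j-r_j)$ among all schedules, and let $O(t)$ be the set of jobs alive in it at time $t$. Then, at every time $t$, $$|A(t)\setminus O(t)|\le\Big(3+\frac{2}{1-\alpha}\Big)\,|O(t)|.$$ -/

import Mathlib

/-- An instance of single-machine scheduling with job set `J`: every job has a positive
processing time `p j` and a release date `r j ≥ 0`. -/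
structure SchedInstance (J : Type*) where
  p : J → ℝ
  r : J → ℝ
  p_pos : ∀ j, 0 < p j
  r_nonneg : ∀ j, 0 ≤ r j

/-- A feasible preemptive schedule on one machine of speed `1`. At time `u` job `j` is processed at
rate `rate j u`, so that several jobs may share the machine. No job is processed before its
release, no job receives more than its processing time, and every job is eventually completed. -/
structure Schedule {J : Type*} [Fintype J] (I : SchedInstance J) where
  rate : J → ℝ → ℝ
  measurable_rate : ∀ j, Measurable (rate j)
  rate_nonneg : ∀ j u, 0 ≤ rate j u
  sum_rate_le_one : ∀ u, ∑ j, rate j u ≤ 1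
  rate_eq_zero_of_lt_release : ∀ j u, u < I.r j → rate j u = 0
  processed_le : ∀ j t, ∫ u in (0 : ℝ)..t, rate j u ≤ I.p j
  completes : ∀ j, ∃ t, ∫ u in (0 : ℝ)..t, rate j u = I.p j

noncomputable section

namespace Schedule

variable {J : Type*} [Fintype J] {I : SchedInstance J}

/-- `y_j(t)`: the amount of processing that `j` has received until time `t`. -/
def y (S : Schedule I) (j : J) (t : ℝ) : ℝ := ∫ u in (0 : ℝ)..t, S.rate j u

/-- `p_j(t) = p_j - y_j(t)`: the remaining processing time of `j` at time `t`. -/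
def rem (S : Schedule I) (j : J) (t : ℝ) : ℝ := I.p j - S.y j t

/-- `C_j`: the completion time of `j`, i.e. the earliest time at which `j` is fully processed. -/
def completion (S : Schedule I) (j : J) : ℝ := sInf {t | S.y j t = I.p j}

/-- The total flow time `∑_j (C_j - r_j)`. -/
def totalFlow (S : Schedule I) : ℝ := ∑ j, (S.completion j - I.r j)

/-- The schedule minimizes the total flow time among all feasible schedules of the instance. -/
def IsOptimal (S : Schedule I) : Prop := ∀ S' : Schedule I, S.totalFlow ≤ S'.totalFlow

open Classical in
/-- The set `{j | r_j ≤ t < C_j}` of jobs that are alive (available) at time `t`. -/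
def alive (S : Schedule I) (t : ℝ) : Finset J :=
  Finset.univ.filter fun j => I.r j ≤ t ∧ t < S.completion j

/-- `s_j`: the time at which `j` emits its signal, i.e. the earliest time (from its release on) at
which an `α`-fraction of `j` has been processed. -/
def emission (S : Schedule I) (α : ℝ) (j : J) : ℝ :=
  sInf {t | I.r j ≤ t ∧ S.y j t = α * I.p j}

open Classical in
/-- `N(t)`: the non-clairvoyant jobs, i.e. the alive jobs with `y_j(t) ≤ α p_j`. For `α = 0` (the
clairvoyant model) processing times are known at arrival, and there are no such jobs. -/
def nonclairvoyant (S : Schedule I) (α t : ℝ) : Finset J :=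
  (S.alive t).filter fun j => α ≠ 0 ∧ S.y j t ≤ α * I.p j

open Classical in
/-- `C(t)`: the clairvoyant jobs, i.e. the alive jobs with `y_j(t) > α p_j` (all alive jobs if
`α = 0`). -/
def clairvoyant (S : Schedule I) (α t : ℝ) : Finset J :=
  (S.alive t).filter fun j => α = 0 ∨ α * I.p j < S.y j t

/-- The condition `min_{k ∈ C(t)} p_k(t) ≤ (1-α)/α * min_{j ∈ N(t)} y_j(t)`, where the minimum over
the empty set is `∞` (and the condition is not met if `C(t)` is empty). -/
def PrefersClairvoyant (S : Schedule I) (α t : ℝ) : Prop :=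
  ∃ k ∈ S.clairvoyant α t, ∀ j ∈ S.nonclairvoyant α t, S.rem k t ≤ (1 - α) / α * S.y j t

/-- At time `t` the machine only processes one job of `C(t)`, namely one with the smallest remaining
processing time, and among these one that emitted last; other ties are broken arbitrarily. -/
def RunsSRPT (S : Schedule I) (α t : ℝ) : Prop :=
  ∃ k ∈ S.clairvoyant α t,
    (∀ j ∈ S.clairvoyant α t, S.rem k t ≤ S.rem j t) ∧
    (∀ j ∈ S.clairvoyant α t, S.rem j t = S.rem k t → S.emission α j ≤ S.emission α k) ∧
    S.rate k t = 1 ∧ ∀ j, j ≠ k → S.rate j t = 0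

open Classical in
/-- The jobs of `N(t)` that have received the smallest amount of processing so far. -/
def leastProcessed (S : Schedule I) (α t : ℝ) : Finset J :=
  (S.nonclairvoyant α t).filter fun j => ∀ i ∈ S.nonclairvoyant α t, S.y j t ≤ S.y i t

/-- At time `t` the machine is shared evenly among the jobs of `N(t)` that have received the
smallest amount of processing so far (and it is idle if `N(t)` is empty). -/
def RunsSETF (S : Schedule I) (α t : ℝ) : Prop :=
  (∀ j ∈ S.leastProcessed α t, S.rate j t = 1 / ((S.leastProcessed α t).card : ℝ)) ∧
  ∀ j, j ∉ S.leastProcessed α t → S.rate j t = 0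

/-- `S` is a schedule of the `α`-clairvoyant algorithm: at every time `t` it runs SRPT on `C(t)` if
`min_{C(t)} p_k(t) ≤ (1-α)/α * min_{N(t)} y_j(t)`, and SETF on `N(t)` otherwise. -/
def IsAlgorithmSchedule (S : Schedule I) (α : ℝ) : Prop :=
  ∀ t, 0 ≤ t →
    (S.PrefersClairvoyant α t → S.RunsSRPT α t) ∧ (¬ S.PrefersClairvoyant α t → S.RunsSETF α t)

end Schedule

end

open Filter MeasureTheory Set Topology
open scoped Finset

/-!
Let the priority of a job be its remaining time or, if smaller, `(1 - α) / α` times its processed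
amount; the algorithm always works on released unfinished jobs of smallest priority. Fix a threshold
`x` and a time `t`, and let `s` be the last time up to `t` at which every unfinished job released
before has priority at least `x`. From `s` to `t` the machine is busy with jobs of priority below
`x`, so comparing its work with the work that any other schedule can do on the jobs released from
`s` on bounds the total remaining time, over the jobs alive only in the algorithm's schedule and
with remaining time at most `x`, by `x` plus the time spent on the jobs `i` alive in the other
schedule with `(1 - α) y_i ≤ x`. The summand `x` pays for the jobs released before `s`: unless `x`
is one of finitely many levels at which two signalled jobs tie, only one of them is touched. Having
these inequalities for all `x` yields `|A \ O| ≤ (1 + 1 / (1 - α)) |O| + 1`, and the last summand is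
absorbed by `|O|`, because `A` is empty as soon as `O` is.
-/

/-! ### Counting lemmas -/

theorem sum_mul_nonpos_of_forall_sum_superlevel_nonpos {ι : Type*} (s : Finset ι) (m w : ι → ℝ)
    (hw : ∀ i ∈ s, 0 ≤ w i) (h : ∀ c, 0 < c → ∑ i ∈ s with c ≤ w i, m i ≤ 0) :
    ∑ i ∈ s, m i * w i ≤ 0 := by
  induction s using Finset.strongInduction generalizing w with | H s ih =>
  rcases s.eq_empty_or_nonempty with rfl | hs
  · simp
  obtain ⟨a, ha, hmin⟩ := s.exists_min_image w hs
  have hbottom : w a * ∑ i ∈ s, m i ≤ 0 := by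
    rcases (hw a ha).eq_or_lt with hzero | hpos
    · simp [← hzero]
    · refine mul_nonpos_of_nonneg_of_nonpos hpos.le ?_
      simpa only [Finset.filter_true_of_mem hmin] using h (w a) hpos
  have hrest : ∑ i ∈ s with w a < w i, m i * (w i - w a) ≤ 0 := by
    refine ih _ (Finset.filter_ssubset.2 ⟨a, ha, lt_irrefl (w a)⟩) _
      (fun i hi => sub_nonneg.2 (hmin i (Finset.mem_filter.1 hi).1)) fun c hc => ?_
    have hfilter : ({i ∈ s | w a < w i} : Finset ι).filter (c ≤ w · - w a) =
        {i ∈ s | c + w a ≤ w i} := by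
      rw [Finset.filter_filter]
      refine Finset.filter_congr fun i _ => ?_
      rw [le_sub_iff_add_le, and_iff_right_of_imp fun hi => by linarith]
    exact hfilter ▸ h _ (add_pos_of_pos_of_nonneg hc (hw a ha))
  calc ∑ i ∈ s, m i * w i = ∑ i ∈ s, m i * (w i - w a) + w a * ∑ i ∈ s, m i := by
        rw [Finset.mul_sum, ← Finset.sum_add_distrib]
        exact Finset.sum_congr rfl fun i _ => by ring
    _ = ∑ i ∈ s with w a < w i, m i * (w i - w a) + w a * ∑ i ∈ s, m i := by
        rw [Finset.sum_filter_of_ne fun i hi hne => (hmin i hi).lt_of_ne fun heq => hne ?_]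
        rw [heq, sub_self, mul_zero]
    _ ≤ 0 := add_nonpos hrest hbottom

theorem ite_le_inv_eq_ite_le_inv {b c : ℝ} (hb : 0 ≤ b) (hc : 0 < c) :
    (if c ≤ b⁻¹ then b else 0) = if b ≤ c⁻¹ then b else 0 := by
  rcases hb.eq_or_lt with rfl | hb
  · simp
  · exact if_congr (le_inv_comm₀ hc hb) rfl rfl

/-- Weigh every term by its inverse: the `a j` then count `1` each, and the `b i` at most `1`. -/
theorem card_le_mul_card_of_forall_sum_le {ι κ : Type*} {A : Finset ι} {B : Finset κ} {a : ι → ℝ}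
    {b : κ → ℝ} {K : ℝ} (hK : 0 ≤ K) (ha : ∀ j ∈ A, 0 < a j) (hb : ∀ i ∈ B, 0 ≤ b i)
    (h : ∀ x, 0 < x → ∑ j ∈ A with a j ≤ x, a j ≤ K * ∑ i ∈ B with b i ≤ x, b i) :
    (A.card : ℝ) ≤ K * B.card := by
  have hweighted : ∑ j ∈ A, a j * (a j)⁻¹ - K * ∑ i ∈ B, b i * (b i)⁻¹ ≤ 0 := by
    convert sum_mul_nonpos_of_forall_sum_superlevel_nonpos (A.disjSum B)
      (Sum.elim a fun i => -K * b i) (Sum.elim (fun j => (a j)⁻¹) fun i => (b i)⁻¹) ?_ ?_ using 1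
    · simp [Finset.sum_disjSum, Finset.mul_sum, mul_assoc, sub_eq_add_neg]
    · simpa [or_imp, forall_and] using ⟨fun j hj => (ha j hj).le, hb⟩
    · intro c hc
      have hc' := h c⁻¹ (inv_pos.2 hc)
      rw [Finset.sum_filter, Finset.sum_filter,
        ← Finset.sum_congr rfl fun j hj => ite_le_inv_eq_ite_le_inv (ha j hj).le hc,
        ← Finset.sum_congr rfl fun i hi => ite_le_inv_eq_ite_le_inv (hb i hi) hc] at hc'
      rw [← sub_nonpos, sub_eq_add_neg, ← neg_mul, Finset.mul_sum] at hc'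
      simp only [mul_ite, mul_zero] at hc'
      simp only [Finset.sum_filter, Finset.sum_disjSum, Sum.elim_inl, Sum.elim_inr]
      exact hc'
  have hA : ∑ j ∈ A, a j * (a j)⁻¹ = A.card := by
    simp [Finset.sum_congr rfl fun j hj => mul_inv_cancel₀ (ha j hj).ne']
  have hB : ∑ i ∈ B, b i * (b i)⁻¹ ≤ B.card := by
    simpa using Finset.sum_le_card_nsmul B _ 1 fun i _ => mul_inv_le_one (a := b i)
  calc (A.card : ℝ) ≤ K * ∑ i ∈ B, b i * (b i)⁻¹ := by linarith
    _ ≤ K * B.card := mul_le_mul_of_nonneg_left hB hK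

theorem exists_subset_card_le_forall_exists_fiber_max {ι β : Type*} [DecidableEq β]
    (A : Finset ι) (φ : ι → β) (a : ι → ℝ) :
    ∃ R ⊆ A, R.card ≤ (A.image φ).card ∧ ∀ j ∈ A, ∃ k ∈ R, φ k = φ j ∧ a j ≤ a k := by
  classical
  have hmax : ∀ v ∈ A.image φ, ∃ k ∈ A, φ k = v ∧ ∀ j ∈ A, φ j = v → a j ≤ a k := by
    intro v hv
    obtain ⟨k, hk, hmax⟩ := Finset.exists_max_image {j ∈ A | φ j = v} a
      (by simpa [Finset.Nonempty] using hv)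
    rw [Finset.mem_filter] at hk
    exact ⟨k, hk.1, hk.2, fun j hj hjv => hmax j (Finset.mem_filter.2 ⟨hj, hjv⟩)⟩
  choose top htop_mem htop_eq htop_max using hmax
  refine ⟨(A.image φ).attach.image fun v : {v // v ∈ A.image φ} => top v v.2, ?_, ?_,
    fun j hj => ?_⟩
  · exact Finset.image_subset_iff.2 fun v _ => htop_mem v v.2
  · exact Finset.card_image_le.trans_eq Finset.card_attach
  · have hφ := Finset.mem_image_of_mem φ hj
    exact ⟨top (φ j) hφ, Finset.mem_image_of_mem _ (Finset.mem_attach _ ⟨φ j, hφ⟩), htop_eq _ hφ,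
      htop_max _ hφ j hj rfl⟩

theorem sum_sdiff_le_of_forall_sum_le_add {ι κ : Type*} [DecidableEq ι] {A R : Finset ι}
    {B : Finset κ} {a : ι → ℝ} {b : κ → ℝ} {K : ℝ} (hK : 0 ≤ K) (ha : ∀ j ∈ A, 0 < a j)
    (hb : ∀ i ∈ B, 0 ≤ b i)
    (h : ∀ x, 0 < x → ∑ j ∈ A with a j ≤ x, a j ≤ x + K * ∑ i ∈ B with b i ≤ x, b i)
    (hRA : R ⊆ A)
    (hR : ∀ j ∈ A, ∃ k ∈ R, a j ≤ a k ∧ ∀ i ∈ B, b i ≤ a k → b i ≤ a j) (x : ℝ) :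
    ∑ j ∈ A \ R with a j ≤ x, a j ≤ K * ∑ i ∈ B with b i ≤ x, b i := by
  rcases (Finset.filter (a · ≤ x) (A \ R)).eq_empty_or_nonempty with hempty | hne
  · rw [hempty, Finset.sum_empty]
    exact mul_nonneg hK (Finset.sum_nonneg fun i hi => hb i (Finset.mem_filter.1 hi).1)
  obtain ⟨j, hj, hmax⟩ := Finset.exists_max_image _ a hne
  simp only [Finset.mem_filter, Finset.mem_sdiff] at hj hmax
  obtain ⟨k, hkR, hjk, hbelow⟩ := hR j hj.1.1
  have hsub : insert k {i ∈ A \ R | a i ≤ x} ⊆ {i ∈ A | a i ≤ a k} := by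
    refine Finset.insert_subset (by simp [hRA hkR]) fun i hi => ?_
    simp only [Finset.mem_filter, Finset.mem_sdiff] at hi ⊢
    exact ⟨hi.1.1, (hmax i hi).trans hjk⟩
  have hsum : a k + ∑ i ∈ A \ R with a i ≤ x, a i ≤ a k + K * ∑ i ∈ B with b i ≤ a k, b i := by
    rw [← Finset.sum_insert (by simp [hkR])]
    exact (Finset.sum_le_sum_of_subset_of_nonneg hsub
      fun i hi _ => (ha i (Finset.mem_filter.1 hi).1).le).trans (h _ (ha k (hRA hkR)))
  refine (le_of_add_le_add_left hsum).trans (mul_le_mul_of_nonneg_left ?_ hK)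
  exact Finset.sum_le_sum_of_subset_of_nonneg
    (Finset.monotone_filter_right _ fun i hi hik => (hbelow i hi hik).trans hj.2)
    fun i hi _ => hb i (Finset.mem_filter.1 hi).1

/-- Group the `a j` by the number of `b i` below them. Without the largest member of each of these
at most `|B| + 1` groups, the summand `x` can be dropped. -/
theorem card_le_of_forall_sum_le_add {ι κ : Type*} {A : Finset ι} {B : Finset κ} {a : ι → ℝ}
    {b : κ → ℝ} {K : ℝ} (hK : 0 ≤ K) (ha : ∀ j ∈ A, 0 < a j) (hb : ∀ i ∈ B, 0 ≤ b i)
    (h : ∀ x, 0 < x → ∑ j ∈ A with a j ≤ x, a j ≤ x + K * ∑ i ∈ B with b i ≤ x, b i) :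
    (A.card : ℝ) ≤ (K + 1) * B.card + 1 := by
  classical
  obtain ⟨R, hRA, hRcard, hR⟩ := exists_subset_card_le_forall_exists_fiber_max A
    (fun j => #{i ∈ B | b i ≤ a j}) a
  have hRcard' : R.card ≤ B.card + 1 := by
    refine hRcard.trans ((Finset.card_le_card (Finset.image_subset_iff.2 fun j _ => ?_)).trans_eq
      (Finset.card_range _))
    exact Finset.mem_range_succ_iff.2 (Finset.card_filter_le _ _)
  have hsame : ∀ j ∈ A, ∃ k ∈ R, a j ≤ a k ∧ ∀ i ∈ B, b i ≤ a k → b i ≤ a j := by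
    intro j hj
    obtain ⟨k, hk, hcard, hjk⟩ := hR j hj
    have hfilter : ({i ∈ B | b i ≤ a j} : Finset κ) = {i ∈ B | b i ≤ a k} :=
      Finset.eq_of_subset_of_card_le
        (Finset.monotone_filter_right _ fun i _ hi => hi.trans hjk) hcard.le
    exact ⟨k, hk, hjk, fun i hi => (Finset.filter_inj'.1 hfilter hi).2⟩
  have hrest : ((A \ R).card : ℝ) ≤ K * B.card :=
    card_le_mul_card_of_forall_sum_le hK (fun j hj => ha j (Finset.sdiff_subset hj)) hb
      fun x _ => sum_sdiff_le_of_forall_sum_le_add hK ha hb h hRA hsame x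
  calc (A.card : ℝ) ≤ (A \ R).card + R.card := by
        exact_mod_cast Finset.card_le_card_sdiff_add_card
    _ ≤ K * B.card + (B.card + 1) := add_le_add hrest (by exact_mod_cast hRcard')
    _ = (K + 1) * B.card + 1 := by ring

/-! ### Functions of a real variable -/

theorem le_of_ae_nonneg_of_mem_Ioo {f h : ℝ → ℝ} (hf : Continuous f)
    (hfh : ∀ a b, f b - f a = ∫ u in a..b, h u) {a b l c : ℝ} (hab : a ≤ b) (hlc : l < c)
    (ha : c ≤ f a) (hh : ∀ᵐ u, u ∈ Ioc a b → f u ∈ Ioo l c → 0 ≤ h u) : c ≤ f b := by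
  refine IsClosed.mem_of_ge_of_forall_exists_gt (s := {u | c ≤ f u})
    ((isClosed_le continuous_const hf).inter isClosed_Icc) ha hab fun v ⟨hcv, hav, hvb⟩ => ?_
  by_contra hempty
  have hlt : ∀ u ∈ Ioc v b, f u < c := fun u hu => not_le.1 fun hcu => hempty ⟨u, hcu, hu⟩
  have hnear : ∀ᶠ u in 𝓝[>] v, l < f u ∧ u ≤ b :=
    nhdsWithin_le_nhds ((hf.continuousAt.eventually_const_lt (hlc.trans_le hcv)).and
      (eventually_le_nhds hvb))
  obtain ⟨w, hvw, hw⟩ := mem_nhdsGT_iff_exists_Ioc_subset.1 hnear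
  have hint : 0 ≤ ∫ u in v..w, h u := by
    rw [intervalIntegral.integral_of_le (le_of_lt hvw)]
    refine setIntegral_nonneg_of_ae_restrict ((ae_restrict_iff' measurableSet_Ioc).2 ?_)
    filter_upwards [hh] with u hu huvw
    have hub := (hw huvw).2
    exact hu ⟨hav.trans_lt huvw.1, hub⟩ ⟨(hw huvw).1, hlt u ⟨huvw.1, hub⟩⟩
  have hfw := hlt w ⟨hvw, (hw ⟨hvw, le_rfl⟩).2⟩
  have hcv : c ≤ f v := hcv
  linarith [hfh v w]

theorem eventually_filter_le_eq {ι : Type*} (s : Finset ι) (v : ι → ℝ) (x : ℝ) :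
    ∀ᶠ z in 𝓝[>] x, ({i ∈ s | v i ≤ z} : Finset ι) = {i ∈ s | v i ≤ x} := by
  have hlt : ∀ᶠ z in 𝓝[>] x, ∀ i ∈ s, x < v i → z < v i := by
    simp only [Finset.eventually_all, eventually_all]
    exact fun i _ hi => nhdsWithin_le_nhds (eventually_lt_nhds hi)
  filter_upwards [hlt, self_mem_nhdsWithin] with z hz hxz
  refine Finset.filter_congr fun i hi => ⟨fun hle => ?_, fun hle => hle.trans (le_of_lt hxz)⟩
  exact not_lt.1 fun hxi => (hz i hi hxi).not_ge hle

/-! ### Work done by a schedule -/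

namespace Schedule

variable {J : Type*} [Fintype J] {I : SchedInstance J} (S : Schedule I)

theorem rate_le_one (j : J) (u : ℝ) : S.rate j u ≤ 1 :=
  (Finset.single_le_sum (f := fun i => S.rate i u) (fun i _ => S.rate_nonneg i u)
    (Finset.mem_univ j)).trans (S.sum_rate_le_one u)

theorem locallyIntegrable_rate (j : J) : LocallyIntegrable (S.rate j) := by
  refine (locallyIntegrable_const (1 : ℝ)).mono (S.measurable_rate j).aestronglyMeasurable
    (Eventually.of_forall fun u => ?_)
  rw [Real.norm_of_nonneg (S.rate_nonneg j u), norm_one]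
  exact S.rate_le_one j u

theorem intervalIntegrable_rate (j : J) (a b : ℝ) : IntervalIntegrable (S.rate j) volume a b :=
  ((S.locallyIntegrable_rate j).integrableOn_isCompact isCompact_uIcc).intervalIntegrable

theorem y_sub_y (j : J) (a b : ℝ) : S.y j b - S.y j a = ∫ u in a..b, S.rate j u :=
  intervalIntegral.integral_interval_sub_left (S.intervalIntegrable_rate j _ _)
    (S.intervalIntegrable_rate j _ _)

theorem ae_hasDerivAt_y (j : J) : ∀ᵐ u, HasDerivAt (S.y j) (S.rate j u) u := by
  filter_upwards [LocallyIntegrable.ae_hasDerivAt_integral (S.locallyIntegrable_rate j)]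
    with u hu using hu 0

theorem continuous_y (j : J) : Continuous (S.y j) :=
  intervalIntegral.continuous_primitive (S.intervalIntegrable_rate j) 0

theorem continuous_rem (j : J) : Continuous (S.rem j) :=
  continuous_const.sub (S.continuous_y j)

theorem y_mono (j : J) : Monotone (S.y j) := fun a b hab => by
  rw [← sub_nonneg, S.y_sub_y]
  exact intervalIntegral.integral_nonneg hab fun u _ => S.rate_nonneg j u

theorem rem_anti (j : J) : Antitone (S.rem j) := fun _ _ hab =>
  sub_le_sub_left (S.y_mono j hab) _

theorem y_eq_zero {j : J} {u : ℝ} (hu : u ≤ I.r j) : S.y j u = 0 := by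
  refine intervalIntegral.integral_zero_ae ?_
  filter_upwards [Measure.ae_ne volume (I.r j)] with v hne hv
  exact S.rate_eq_zero_of_lt_release j v
    ((hv.2.trans (max_le (I.r_nonneg j) hu)).lt_of_ne hne)

theorem y_nonneg (j : J) (u : ℝ) : 0 ≤ S.y j u :=
  (S.y_eq_zero (min_le_right u (I.r j))).ge.trans (S.y_mono j (min_le_left _ _))

theorem rem_nonneg (j : J) (u : ℝ) : 0 ≤ S.rem j u :=
  sub_nonneg.2 (S.processed_le j u)

theorem rem_le_p (j : J) (u : ℝ) : S.rem j u ≤ I.p j :=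
  sub_le_self _ (S.y_nonneg j u)

theorem isLeast_completion (j : J) : IsLeast {u | S.y j u = I.p j} (S.completion j) := by
  refine (isClosed_eq (S.continuous_y j) continuous_const).isLeast_csInf (S.completes j)
    ⟨I.r j, fun u hu => le_of_not_ge fun hr => (I.p_pos j).ne' ?_⟩
  rw [← S.y_eq_zero hr]
  exact Eq.symm hu

theorem lt_completion_iff {j : J} {u : ℝ} : u < S.completion j ↔ 0 < S.rem j u := by
  obtain ⟨hmem, hleast⟩ := S.isLeast_completion j
  rw [← not_le, ← not_le, not_iff_not]
  refine ⟨fun h => ?_, fun h => hleast ?_⟩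
  · exact (S.rem_anti j h).trans_eq (sub_eq_zero.2 (Eq.symm hmem))
  · exact (sub_eq_zero.1 (h.antisymm (S.rem_nonneg j u))).symm

theorem mem_alive {j : J} {u : ℝ} : j ∈ S.alive u ↔ I.r j ≤ u ∧ 0 < S.rem j u := by
  simp [alive, S.lt_completion_iff]

theorem y_le_of_ae_rate_eq_zero {j : J} {s t a b : ℝ} (hst : s ≤ t) (hab : a < b)
    (hs : S.y j s ≤ a) (h : ∀ᵐ u, u ∈ Ioc s t → S.y j u ∈ Ioo a b → S.rate j u = 0) :
    S.y j t ≤ a := by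
  refine neg_le_neg_iff.1 (le_of_ae_nonneg_of_mem_Ioo (f := fun u => -S.y j u)
    (h := fun u => -S.rate j u) (S.continuous_y j).neg (fun a b => ?_) hst (neg_lt_neg hab)
    (neg_le_neg hs) ?_)
  · rw [intervalIntegral.integral_neg, ← S.y_sub_y, neg_sub_neg, neg_sub]
  · filter_upwards [h] with u hu hmem hlt
    rw [hu hmem ⟨neg_lt_neg_iff.1 hlt.2, neg_lt_neg_iff.1 hlt.1⟩, neg_zero]

theorem sum_y_sub_y (s t : ℝ) :
    ∑ j, (S.y j t - S.y j s) = ∫ u in s..t, ∑ j, S.rate j u := by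
  simp_rw [S.y_sub_y]
  exact (intervalIntegral.integral_finsetSum fun j _ => S.intervalIntegrable_rate j s t).symm

theorem sum_y_sub_y_le {s t : ℝ} (hst : s ≤ t) : ∑ j, (S.y j t - S.y j s) ≤ t - s := by
  have hint : IntervalIntegrable (fun u => ∑ j, S.rate j u) volume s t := by
    simpa only [Finset.sum_fn] using
      IntervalIntegrable.sum Finset.univ fun j _ => S.intervalIntegrable_rate j s t
  calc ∑ j, (S.y j t - S.y j s) = ∫ u in s..t, ∑ j, S.rate j u := S.sum_y_sub_y s t
    _ ≤ ∫ _ in s..t, (1 : ℝ) :=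
        intervalIntegral.integral_mono hst hint intervalIntegrable_const S.sum_rate_le_one
    _ = t - s := by simp

theorem sum_y_sub_y_eq {s t : ℝ} (hst : s ≤ t) (h : ∀ u ∈ Ioc s t, ∑ j, S.rate j u = 1) :
    ∑ j, (S.y j t - S.y j s) = t - s := by
  rw [S.sum_y_sub_y, intervalIntegral.integral_congr_ae (g := fun _ => (1 : ℝ))]
  · simp
  · exact Eventually.of_forall fun u hu => h u (uIoc_of_le hst ▸ hu)

theorem y_add_rem (j : J) (u : ℝ) : S.y j u + S.rem j u = I.p j := add_sub_cancel _ _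

theorem y_eq_p {j : J} {t : ℝ} (hr : I.r j ≤ t) (hj : j ∉ S.alive t) : S.y j t = I.p j := by
  have hrem : ¬ 0 < S.rem j t := fun hpos => hj (S.mem_alive.2 ⟨hr, hpos⟩)
  linarith [S.y_add_rem j t, S.rem_nonneg j t]

/-- If `S` never idles on `(s, t]`, it works there at least as much as `S'`, which has completed
every job released from `s` on that is alive in `S` only. -/
theorem sum_rem_le_of_sum_rate_eq_one [DecidableEq J] (S' : Schedule I) {s t : ℝ} (hst : s ≤ t)
    (h : ∀ u ∈ Ioc s t, ∑ j, S.rate j u = 1) :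
    ∑ j ∈ S.alive t \ S'.alive t with s ≤ I.r j, S.rem j t ≤
      ∑ j with I.r j < s, (S.y j t - S.y j s) + ∑ i ∈ S'.alive t with s ≤ I.r i, S.y i t := by
  have hjob (j : J) : (if j ∈ ({j ∈ S.alive t \ S'.alive t | s ≤ I.r j} : Finset J)
        then S.rem j t else 0) + (S.y j t - S.y j s) ≤
      (if I.r j < s then S.y j t - S.y j s else 0) +
        (if j ∈ ({i ∈ S'.alive t | s ≤ I.r i} : Finset J) then S.y j t else 0) +
        (S'.y j t - S'.y j s) := by
    simp only [Finset.mem_filter, Finset.mem_sdiff]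
    rcases lt_or_ge (I.r j) s with hold | hnew
    · simp [hold, hold.not_ge, S'.y_mono j hst]
    · simp only [hnew, hnew.not_gt, S.y_eq_zero hnew, S'.y_eq_zero hnew, and_true, if_false]
      by_cases hO : j ∈ S'.alive t
      · simp [hO, S'.y_nonneg j t]
      rcases le_or_gt (I.r j) t with hr | hr
      · have hsplit := S.y_add_rem j t
        have hnonneg := S.rem_nonneg j t
        simp only [hO, not_false_eq_true, and_true, if_false, S'.y_eq_p hr hO]
        split_ifs <;> linarith
      · have hA : j ∉ S.alive t := fun hA => hr.not_ge (S.mem_alive.1 hA).1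
        simp [hO, hA, S.y_eq_zero hr.le, S'.y_eq_zero hr.le]
  have hsum := Finset.sum_le_sum fun j (_ : j ∈ Finset.univ) => hjob j
  simp only [Finset.sum_add_distrib, Finset.sum_ite_mem, Finset.univ_inter, ← Finset.sum_filter]
    at hsum
  linarith [S.sum_y_sub_y_eq hst h, S'.sum_y_sub_y_le hst]

end Schedule

/-! ### Priorities and ties -/

namespace Schedule

variable {J : Type*} [Fintype J] {I : SchedInstance J}

/-- The priority of `j` at time `u`: its remaining processing time or, if smaller, `(1-α)/α` times
the processing it has received (read as `∞` for `α = 0`, where the division would give `0`). The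
algorithm always processes alive jobs of smallest priority. -/
noncomputable def priority (S : Schedule I) (α : ℝ) (j : J) (u : ℝ) : ℝ :=
  if α = 0 then S.rem j u else min ((1 - α) / α * S.y j u) (S.rem j u)

/-- `j` has been released by time `u` and an `α`-fraction of it has been processed. -/
def HasSignalled (S : Schedule I) (α : ℝ) (j : J) (u : ℝ) : Prop :=
  I.r j ≤ u ∧ α * I.p j ≤ S.y j u

variable {S : Schedule I} {α : ℝ}

theorem continuous_priority (j : J) : Continuous (S.priority α j) := by
  unfold priority
  split_ifs
  · exact S.continuous_rem j
  · exact (continuous_const.mul (S.continuous_y j)).min (S.continuous_rem j)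

theorem priority_le_rem (j : J) (u : ℝ) : S.priority α j u ≤ S.rem j u := by
  unfold priority
  split_ifs
  · exact le_rfl
  · exact min_le_right _ _

theorem le_priority_iff (hα0 : 0 ≤ α) {j : J} {u x : ℝ} :
    x ≤ S.priority α j u ↔ α * x ≤ (1 - α) * S.y j u ∧ x ≤ S.rem j u := by
  unfold priority
  split_ifs with hα
  · subst hα
    simpa using fun _ => S.y_nonneg j u
  · rw [le_min_iff, div_mul_eq_mul_div, le_div_iff₀ (hα0.lt_of_ne' hα), mul_comm x α]

theorem priority_eq_rem (hα0 : 0 ≤ α) {j : J} {u : ℝ} (h : α * I.p j ≤ S.y j u) :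
    S.priority α j u = S.rem j u := by
  refine (priority_le_rem j u).antisymm ((le_priority_iff hα0).2 ⟨?_, le_rfl⟩)
  rw [rem]
  linarith

namespace HasSignalled

variable {j : J} {u v : ℝ}

theorem mono (hj : S.HasSignalled α j u) (huv : u ≤ v) : S.HasSignalled α j v :=
  ⟨hj.1.trans huv, hj.2.trans (S.y_mono j huv)⟩

theorem nonneg (hj : S.HasSignalled α j u) : 0 ≤ u :=
  (I.r_nonneg j).trans hj.1

theorem priority_eq_rem (hj : S.HasSignalled α j u) (hα0 : 0 ≤ α) :
    S.priority α j u = S.rem j u :=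
  Schedule.priority_eq_rem hα0 hj.2

end HasSignalled

theorem mem_clairvoyant {j : J} {u : ℝ} :
    j ∈ S.clairvoyant α u ↔ j ∈ S.alive u ∧ (α = 0 ∨ α * I.p j < S.y j u) := by
  simp [clairvoyant]

theorem mem_nonclairvoyant {j : J} {u : ℝ} :
    j ∈ S.nonclairvoyant α u ↔ j ∈ S.alive u ∧ α ≠ 0 ∧ S.y j u ≤ α * I.p j := by
  simp [nonclairvoyant]

theorem mem_leastProcessed {j : J} {u : ℝ} :
    j ∈ S.leastProcessed α u ↔
      j ∈ S.nonclairvoyant α u ∧ ∀ i ∈ S.nonclairvoyant α u, S.y j u ≤ S.y i u := by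
  simp [leastProcessed]

theorem mem_clairvoyant_or_mem_nonclairvoyant {j : J} {u : ℝ} (hj : j ∈ S.alive u) :
    j ∈ S.clairvoyant α u ∨ j ∈ S.nonclairvoyant α u := by
  rw [mem_clairvoyant, mem_nonclairvoyant, ← not_lt]
  tauto

theorem priority_of_mem_clairvoyant (hα0 : 0 ≤ α) {j : J} {u : ℝ}
    (hj : j ∈ S.clairvoyant α u) : S.priority α j u = S.rem j u := by
  refine priority_eq_rem hα0 ?_
  rcases (mem_clairvoyant.1 hj).2 with rfl | hsignalled
  · simpa using S.y_nonneg j u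
  · exact hsignalled.le

theorem priority_of_mem_nonclairvoyant (hα0 : 0 ≤ α) {j : J} {u : ℝ}
    (hj : j ∈ S.nonclairvoyant α u) : S.priority α j u = (1 - α) / α * S.y j u := by
  obtain ⟨-, hα, hy⟩ := mem_nonclairvoyant.1 hj
  rw [priority, if_neg hα, min_eq_left]
  rw [div_mul_eq_mul_div, div_le_iff₀ (hα0.lt_of_ne' hα), rem]
  linarith

namespace IsAlgorithmSchedule

theorem priority_le_of_rate_ne_zero (hS : S.IsAlgorithmSchedule α) (hα0 : 0 ≤ α) (hα1 : α < 1)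
    {k q : J} {u : ℝ} (hu : 0 ≤ u) (hk : S.rate k u ≠ 0) (hq : q ∈ S.alive u) :
    S.priority α k u ≤ S.priority α q u := by
  by_cases hpref : S.PrefersClairvoyant α u
  · obtain ⟨k', -, hmin, -, -, hidle⟩ := (hS u hu).1 hpref
    obtain rfl : k = k' := by_contra fun hne => hk (hidle k hne)
    obtain ⟨k₀, hk₀, hle⟩ := hpref
    refine (priority_le_rem k u).trans ?_
    rcases mem_clairvoyant_or_mem_nonclairvoyant (α := α) hq with hqC | hqN
    · rw [priority_of_mem_clairvoyant hα0 hqC]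
      exact hmin q hqC
    · rw [priority_of_mem_nonclairvoyant hα0 hqN]
      exact (hmin k₀ hk₀).trans (hle q hqN)
  · have hkL : k ∈ S.leastProcessed α u := by_contra fun hne => hk (((hS u hu).2 hpref).2 k hne)
    obtain ⟨hkN, hmin⟩ := mem_leastProcessed.1 hkL
    have hα : 0 ≤ (1 - α) / α := div_nonneg (by linarith) hα0
    rw [priority_of_mem_nonclairvoyant hα0 hkN]
    rcases mem_clairvoyant_or_mem_nonclairvoyant (α := α) hq with hqC | hqN
    · rw [priority_of_mem_clairvoyant hα0 hqC]
      simp only [PrefersClairvoyant, not_exists, not_and, not_forall, not_le] at hpref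
      obtain ⟨j, hjN, hlt⟩ := hpref q hqC
      exact (mul_le_mul_of_nonneg_left (hmin j hjN) hα).trans hlt.le
    · rw [priority_of_mem_nonclairvoyant hα0 hqN]
      exact mul_le_mul_of_nonneg_left (hmin q hqN) hα

theorem rate_eq_zero (hS : S.IsAlgorithmSchedule α) (hα0 : 0 ≤ α) (hα1 : α < 1) {k q : J} {u : ℝ}
    (hu : 0 ≤ u) (hq : q ∈ S.alive u) (hlt : S.priority α q u < S.priority α k u) :
    S.rate k u = 0 :=
  by_contra fun hk => hlt.not_ge (hS.priority_le_of_rate_ne_zero hα0 hα1 hu hk hq)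

theorem sum_rate_eq_one (hS : S.IsAlgorithmSchedule α) {u : ℝ} (hu : 0 ≤ u)
    (hne : (S.alive u).Nonempty) : ∑ j, S.rate j u = 1 := by
  classical
  by_cases hpref : S.PrefersClairvoyant α u
  · obtain ⟨k, -, -, -, hone, hidle⟩ := (hS u hu).1 hpref
    rw [Finset.sum_eq_single k (fun j _ hj => hidle j hj) (by simp), hone]
  · obtain ⟨hrate, hidle⟩ := (hS u hu).2 hpref
    have hN : (S.nonclairvoyant α u).Nonempty := by
      by_contra hN
      rw [Finset.not_nonempty_iff_eq_empty] at hN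
      obtain ⟨j, hj⟩ := hne
      rcases mem_clairvoyant_or_mem_nonclairvoyant (α := α) hj with hjC | hjN
      · exact hpref ⟨j, hjC, by simp [hN]⟩
      · simp [hN] at hjN
    obtain ⟨k, hk, hmin⟩ := Finset.exists_min_image _ (fun j => S.y j u) hN
    have hcard : ((S.leastProcessed α u).card : ℝ) ≠ 0 :=
      Nat.cast_ne_zero.2 (Finset.card_ne_zero_of_mem (mem_leastProcessed.2 ⟨hk, hmin⟩))
    rw [← Finset.sum_subset (Finset.subset_univ (S.leastProcessed α u))
      (fun j _ hj => hidle j hj), Finset.sum_congr rfl hrate, Finset.sum_const, nsmul_eq_mul,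
      mul_one_div_cancel hcard]

theorem rate_eq_zero_or_rate_eq_zero (hS : S.IsAlgorithmSchedule α) {k k' : J} (hne : k ≠ k')
    {u : ℝ} (hu : 0 ≤ u) (hk : α * I.p k < S.y k u) : S.rate k u = 0 ∨ S.rate k' u = 0 := by
  by_cases hpref : S.PrefersClairvoyant α u
  · obtain ⟨k₀, -, -, -, -, hidle⟩ := (hS u hu).1 hpref
    rcases ne_or_eq k k₀ with hkk₀ | rfl
    · exact Or.inl (hidle k hkk₀)
    · exact Or.inr (hidle k' hne.symm)
  · refine Or.inl (((hS u hu).2 hpref).2 k fun hkL => ?_)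
    exact hk.not_ge (mem_nonclairvoyant.1 (mem_leastProcessed.1 hkL).1).2.2

theorem rem_sub_rem_le (hS : S.IsAlgorithmSchedule α) (hα0 : 0 ≤ α) (hα1 : α < 1) {k k' : J}
    {a b : ℝ} (hab : a ≤ b) (hk : S.HasSignalled α k a) (hk' : S.HasSignalled α k' a)
    (hpos : 0 < S.rem k b) (hlt : S.rem k a < S.rem k' a) :
    S.rem k' a - S.rem k a ≤ S.rem k' b - S.rem k b := by
  refine le_of_ae_nonneg_of_mem_Ioo (f := fun u => S.rem k' u - S.rem k u)
    (h := fun u => S.rate k u - S.rate k' u) (l := 0)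
    ((S.continuous_rem k').sub (S.continuous_rem k)) (fun a b => ?_) hab (sub_pos.2 hlt) le_rfl
    (Eventually.of_forall fun u hu hmem => ?_)
  · rw [intervalIntegral.integral_sub (S.intervalIntegrable_rate k a b)
      (S.intervalIntegrable_rate k' a b), ← S.y_sub_y, ← S.y_sub_y]
    simp only [rem]
    ring
  · have hku := hk.mono hu.1.le
    have hku' := hk'.mono hu.1.le
    have hidle : S.rate k' u = 0 := by
      refine hS.rate_eq_zero (q := k) hα0 hα1 hku.nonneg
        (S.mem_alive.2 ⟨hku.1, hpos.trans_le (S.rem_anti k hu.2)⟩) ?_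
      rw [hku.priority_eq_rem hα0, hku'.priority_eq_rem hα0]
      exact sub_pos.1 hmem.1
    rw [hidle, sub_zero]
    exact S.rate_nonneg k u

theorem rem_eq_rem_of_le (hS : S.IsAlgorithmSchedule α) (hα0 : 0 ≤ α) (hα1 : α < 1) {k k' : J}
    {a b : ℝ} (hab : a ≤ b) (hk : S.HasSignalled α k a) (hk' : S.HasSignalled α k' a)
    (hpos : 0 < S.rem k b) (htie : S.rem k b = S.rem k' b) : S.rem k a = S.rem k' a := by
  rcases lt_trichotomy (S.rem k a) (S.rem k' a) with hlt | heq | hgt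
  · linarith [hS.rem_sub_rem_le hα0 hα1 hab hk hk' hpos hlt]
  · exact heq
  · linarith [hS.rem_sub_rem_le hα0 hα1 hab hk' hk (htie ▸ hpos) hgt]

/-- Tied jobs have been tied, hence processed at equal rates, ever since they both signalled; but
such jobs do not share the machine. -/
theorem rem_eq_of_tie (hS : S.IsAlgorithmSchedule α) (hα0 : 0 ≤ α) (hα1 : α < 1) {k k' : J}
    (hne : k ≠ k') {a b : ℝ} (hab : a ≤ b) (hk : S.HasSignalled α k a)
    (hk' : S.HasSignalled α k' a) (hpos : 0 < S.rem k b) (htie : S.rem k b = S.rem k' b) :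
    S.rem k a = S.rem k b := by
  refine (S.rem_anti k hab).antisymm' (sub_le_sub_left (S.y_le_of_ae_rate_eq_zero hab
    (lt_add_one (S.y k a)) le_rfl ?_) _)
  filter_upwards [S.ae_hasDerivAt_y k, S.ae_hasDerivAt_y k', Measure.ae_ne volume b]
    with u hderiv hderiv' hub hu hy
  have hnear : S.y k' =ᶠ[𝓝 u] fun w => S.y k w + (I.p k' - I.p k) := by
    filter_upwards [Ioo_mem_nhds hu.1 (hu.2.lt_of_ne hub)] with w hw
    have htie := hS.rem_eq_rem_of_le hα0 hα1 hw.2.le (hk.mono hw.1.le) (hk'.mono hw.1.le) hpos htie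
    simp only [rem] at htie
    linarith
  have hrate : S.rate k' u = S.rate k u :=
    hderiv'.unique ((hderiv.add_const (I.p k' - I.p k)).congr_of_eventuallyEq hnear)
  simpa [hrate] using
    hS.rate_eq_zero_or_rate_eq_zero hne (hk.mono hu.1.le).nonneg (hk.2.trans_lt hy.1)

end IsAlgorithmSchedule

/-- The values that the remaining processing times of `k` and `k'` have in common at some time when
both jobs are alive and have signalled. -/
def tieLevels (S : Schedule I) (α : ℝ) (k k' : J) : Set ℝ :=
  {x | 0 < x ∧ ∃ u, (S.HasSignalled α k u ∧ S.rem k u = x) ∧ S.HasSignalled α k' u ∧ S.rem k' u = x}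

theorem IsAlgorithmSchedule.subsingleton_tieLevels (hS : S.IsAlgorithmSchedule α) (hα0 : 0 ≤ α)
    (hα1 : α < 1) {k k' : J} (hne : k ≠ k') : (S.tieLevels α k k').Subsingleton := by
  rintro _ ⟨hx, u, ⟨hk, rfl⟩, hk', htie⟩ _ ⟨hz, v, ⟨hl, rfl⟩, hl', htie'⟩
  rcases le_total u v with huv | hvu
  · exact hS.rem_eq_of_tie hα0 hα1 hne huv hk hk' hz htie'.symm
  · exact (hS.rem_eq_of_tie hα0 hα1 hne hvu hl hl' hx htie.symm).symm

end Schedule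

/-! ### Busy periods below a threshold -/

namespace Schedule

variable {J : Type*} [Fintype J] {I : SchedInstance J}

/-- Throughout `(s, t]` some alive job has priority less than `x`, so that the algorithm does not
process any job of priority at least `x`. -/
def BusyBelow (S : Schedule I) (α x s t : ℝ) : Prop :=
  ∀ u ∈ Ioc s t, ∃ q ∈ S.alive u, S.priority α q u < x

/-- No job that was released before `s` is alive with priority less than `x` at time `s`. -/
def ClearedBelow (S : Schedule I) (α x s : ℝ) : Prop :=
  ∀ j, I.r j < s → S.rem j s = 0 ∨ x ≤ S.priority α j s

variable {S : Schedule I} {α x s t : ℝ}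

theorem isClosed_clearedBelow (S : Schedule I) (α x : ℝ) :
    IsClosed {s | S.ClearedBelow α x s} := by
  simp only [ClearedBelow, ofPred_forall]
  refine isClosed_iInter fun j => isClosed_imp (isOpen_lt continuous_const continuous_id) ?_
  exact (isClosed_eq (S.continuous_rem j) continuous_const).union
    (isClosed_le continuous_const (continuous_priority j))

theorem exists_clearedBelow_busyBelow (S : Schedule I) (α x : ℝ) (ht : 0 ≤ t) :
    ∃ s ∈ Icc 0 t, S.ClearedBelow α x s ∧ S.BusyBelow α x s t := by
  have hzero : S.ClearedBelow α x 0 := fun j hj => absurd hj (I.r_nonneg j).not_gt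
  obtain ⟨s, ⟨hst, hcleared⟩, hlast⟩ :=
    (isCompact_Icc.inter_right (S.isClosed_clearedBelow α x)).exists_isGreatest
      ⟨0, left_mem_Icc.2 ht, hzero⟩
  refine ⟨s, hst, hcleared, fun u hu => ?_⟩
  by_contra! hbusy
  refine hu.1.not_ge (hlast ⟨⟨hst.1.trans hu.1.le, hu.2⟩, fun j hj => ?_⟩)
  rcases (S.rem_nonneg j u).eq_or_lt with hrem | hrem
  · exact Or.inl hrem.symm
  · exact Or.inr (hbusy j (S.mem_alive.2 ⟨hj.le, hrem⟩))

namespace IsAlgorithmSchedule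

theorem rate_eq_zero_of_busyBelow (hS : S.IsAlgorithmSchedule α) (hα0 : 0 ≤ α) (hα1 : α < 1)
    (hs : 0 ≤ s) (hbusy : S.BusyBelow α x s t) {j : J} {u : ℝ} (hu : u ∈ Ioc s t)
    (hj : x ≤ S.priority α j u) : S.rate j u = 0 := by
  obtain ⟨q, hq, hqx⟩ := hbusy u hu
  exact hS.rate_eq_zero hα0 hα1 (hs.trans hu.1.le) hq (hqx.trans_le hj)

theorem sum_rate_eq_one_of_busyBelow (hS : S.IsAlgorithmSchedule α) (hs : 0 ≤ s)
    (hbusy : S.BusyBelow α x s t) {u : ℝ} (hu : u ∈ Ioc s t) : ∑ j, S.rate j u = 1 :=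
  hS.sum_rate_eq_one (hs.trans hu.1.le) ((hbusy u hu).imp fun _ hq => hq.1)

theorem mul_y_le_of_le_release (hS : S.IsAlgorithmSchedule α) (hα0 : 0 ≤ α) (hα1 : α < 1)
    (hx : 0 ≤ x) (hs : 0 ≤ s) (hst : s ≤ t) (hbusy : S.BusyBelow α x s t) {j : J}
    (hj : s ≤ I.r j) : (1 - α) * S.y j t ≤ x := by
  have hα : 0 < 1 - α := sub_pos.2 hα1
  rcases le_or_gt ((1 - α) * I.p j) x with hp | hp
  · exact (mul_le_mul_of_nonneg_left (S.processed_le j t) hα.le).trans hp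
  have hle : S.y j t ≤ α * x / (1 - α) := by
    refine S.y_le_of_ae_rate_eq_zero (b := I.p j - x) hst ?_ ?_
      (Eventually.of_forall fun u hu hy => ?_)
    · rw [div_lt_iff₀ hα]
      linarith
    · rw [S.y_eq_zero hj]
      positivity
    · refine hS.rate_eq_zero_of_busyBelow hα0 hα1 hs hbusy hu ((le_priority_iff hα0).2 ⟨?_, ?_⟩)
      · exact (div_le_iff₀' hα).1 hy.1.le
      · exact (lt_sub_comm.1 hy.2).le
  calc (1 - α) * S.y j t ≤ α * x := (le_div_iff₀' hα).1 hle
    _ ≤ x := mul_le_of_le_one_left hx hα1.le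

theorem y_eq_of_lt_rem (hS : S.IsAlgorithmSchedule α) (hα0 : 0 ≤ α) (hα1 : α < 1) (hs : 0 ≤ s)
    (hst : s ≤ t) (hbusy : S.BusyBelow α x s t) {j : J} (hj : x ≤ S.priority α j s)
    (hrem : x < S.rem j s) : S.y j t = S.y j s := by
  refine (S.y_mono j hst).antisymm' (S.y_le_of_ae_rate_eq_zero hst (lt_sub_comm.1 hrem) le_rfl
    (Eventually.of_forall fun u hu hy => ?_))
  refine hS.rate_eq_zero_of_busyBelow hα0 hα1 hs hbusy hu ((le_priority_iff hα0).2 ⟨?_, ?_⟩)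
  · exact ((le_priority_iff hα0).1 hj).1.trans
      (mul_le_mul_of_nonneg_left hy.1.le (sub_nonneg.2 hα1.le))
  · exact (lt_sub_comm.1 hy.2).le

theorem y_eq_of_le_rem (hS : S.IsAlgorithmSchedule α) (hα0 : 0 ≤ α) (hα1 : α < 1) (hx : 0 < x)
    (hs : 0 ≤ s) (hst : s ≤ t) (hcleared : S.ClearedBelow α x s) (hbusy : S.BusyBelow α x s t)
    {j : J} (hj : I.r j < s) (hrem : x ≤ S.rem j t) : S.y j t = S.y j s := by
  have hanti := S.rem_anti j hst
  rcases hcleared j hj with hdone | hpriority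
  · linarith
  rcases (hpriority.trans (priority_le_rem j s)).eq_or_lt with heq | hlt
  · linarith [S.y_add_rem j s, S.y_add_rem j t, S.y_mono j hst]
  · exact hS.y_eq_of_lt_rem hα0 hα1 hs hst hbusy hpriority hlt

theorem rem_eq_zero_or_of_rem_lt (hS : S.IsAlgorithmSchedule α) (hα0 : 0 ≤ α) (hα1 : α < 1)
    (hs : 0 ≤ s) (hst : s ≤ t) (hcleared : S.ClearedBelow α x s) (hbusy : S.BusyBelow α x s t)
    {j : J} (hj : I.r j < s) (hrem : S.rem j t < x) :
    S.rem j s = 0 ∨ S.HasSignalled α j s ∧ S.rem j s = x := by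
  refine (hcleared j hj).imp_right fun hpriority => ?_
  obtain ⟨hy, hle⟩ := (le_priority_iff hα0).1 hpriority
  have heq : S.rem j s = x := by
    refine hle.antisymm' (not_lt.1 fun hlt => ?_)
    linarith [hS.y_eq_of_lt_rem hα0 hα1 hs hst hbusy hpriority hlt, S.y_add_rem j s,
      S.y_add_rem j t]
  refine ⟨⟨hj.le, ?_⟩, heq⟩
  rw [← heq, rem] at hy
  linarith

theorem sum_rem_le_of_notMem_tieLevels (hS : S.IsAlgorithmSchedule α) (hα0 : 0 ≤ α) (hα1 : α < 1)
    (hx : 0 < x) (hties : ∀ k k', k ≠ k' → x ∉ S.tieLevels α k k') (hs : 0 ≤ s) (hst : s ≤ t)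
    (hcleared : S.ClearedBelow α x s) (hbusy : S.BusyBelow α x s t) :
    ∑ j with I.r j < s ∧ S.rem j t < x, S.rem j s ≤ x := by
  have hjob := fun j (hj : j ∈ ({j | I.r j < s ∧ S.rem j t < x} : Finset J)) =>
    hS.rem_eq_zero_or_of_rem_lt hα0 hα1 hs hst hcleared hbusy (Finset.mem_filter.1 hj).2.1
      (Finset.mem_filter.1 hj).2.2
  by_cases hk : ∃ k ∈ ({j | I.r j < s ∧ S.rem j t < x} : Finset J), S.rem k s ≠ 0
  · obtain ⟨k, hk, hne⟩ := hk
    have hkx := (hjob k hk).resolve_left hne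
    rw [Finset.sum_eq_single_of_mem k hk fun j hj hjk => ?_, hkx.2]
    exact (hjob j hj).resolve_right fun hjx => hties j k hjk ⟨hx, s, hjx, hkx⟩
  · push Not at hk
    exact (Finset.sum_eq_zero hk).trans_le hx.le

theorem sum_rem_lt_le_of_notMem_tieLevels [DecidableEq J] (hS : S.IsAlgorithmSchedule α)
    (hα0 : 0 ≤ α) (hα1 : α < 1) (S' : Schedule I) (hx : 0 < x)
    (hties : ∀ k k', k ≠ k' → x ∉ S.tieLevels α k k') (ht : 0 ≤ t) :
    ∑ j ∈ S.alive t \ S'.alive t with S.rem j t < x, S.rem j t ≤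
      x + ∑ i ∈ S'.alive t with (1 - α) * S.y i t ≤ x, S.y i t := by
  obtain ⟨s, ⟨hs, hst⟩, hcleared, hbusy⟩ := S.exists_clearedBelow_busyBelow α x ht
  have hnew := S.sum_rem_le_of_sum_rate_eq_one S' hst
    fun u hu => hS.sum_rate_eq_one_of_busyBelow hs hbusy hu
  have hspent : ∑ i ∈ S'.alive t with s ≤ I.r i, S.y i t ≤
      ∑ i ∈ S'.alive t with (1 - α) * S.y i t ≤ x, S.y i t :=
    Finset.sum_le_sum_of_subset_of_nonneg (Finset.monotone_filter_right _ fun i _ hi =>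
      hS.mul_y_le_of_le_release hα0 hα1 hx.le hs hst hbusy hi) fun i _ _ => S.y_nonneg i t
  have hsplit : ∑ j ∈ S.alive t \ S'.alive t with S.rem j t < x, S.rem j t ≤
      ∑ j with I.r j < s ∧ S.rem j t < x, S.rem j t +
        ∑ j ∈ S.alive t \ S'.alive t with s ≤ I.r j, S.rem j t := by
    rw [← Finset.sum_filter_add_sum_filter_not _ fun j => I.r j < s]
    refine add_le_add (Finset.sum_le_sum_of_subset_of_nonneg (fun j hj => ?_)
      fun j _ _ => S.rem_nonneg j t) (Finset.sum_le_sum_of_subset_of_nonneg (fun j hj => ?_)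
      fun j _ _ => S.rem_nonneg j t)
    · simp only [Finset.mem_filter, Finset.mem_univ, true_and] at hj ⊢
      exact ⟨hj.2, hj.1.2⟩
    · simp only [Finset.mem_filter, not_lt] at hj ⊢
      exact ⟨hj.1.1, hj.2⟩
  have hwork : ∑ j with I.r j < s, (S.y j t - S.y j s) =
      ∑ j with I.r j < s ∧ S.rem j t < x, (S.y j t - S.y j s) := by
    rw [← Finset.filter_filter]
    refine (Finset.sum_filter_of_ne fun j hj hne => not_le.1 fun hle => hne ?_).symm
    exact sub_eq_zero.2 (hS.y_eq_of_le_rem hα0 hα1 hx hs hst hcleared hbusy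
      (Finset.mem_filter.1 hj).2 hle)
  have hold : ∑ j with I.r j < s ∧ S.rem j t < x, S.rem j t +
      ∑ j with I.r j < s ∧ S.rem j t < x, (S.y j t - S.y j s) ≤ x := by
    rw [← Finset.sum_add_distrib]
    refine (Finset.sum_congr rfl fun j _ => ?_).trans_le
      (hS.sum_rem_le_of_notMem_tieLevels hα0 hα1 hx hties hs hst hcleared hbusy)
    simp only [rem]
    ring
  linarith

/-- There are only finitely many tie levels, so they are avoided just above `x`. -/
theorem sum_rem_alive_sdiff_le [DecidableEq J] (hS : S.IsAlgorithmSchedule α) (hα0 : 0 ≤ α)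
    (hα1 : α < 1) (S' : Schedule I) (hx : 0 < x) (ht : 0 ≤ t) :
    ∑ j ∈ S.alive t \ S'.alive t with S.rem j t ≤ x, S.rem j t ≤
      x + ∑ i ∈ S'.alive t with (1 - α) * S.y i t ≤ x, S.y i t := by
  have hties : ∀ᶠ z in 𝓝[>] x, ∀ k k', k ≠ k' → z ∉ S.tieLevels α k k' := by
    simp only [eventually_all]
    intro k k' hne
    exact (nhdsGT_le_nhdsNE x).trans (nhdsNE_le_cofinite x)
      (hS.subsingleton_tieLevels hα0 hα1 hne).finite.eventually_cofinite_notMem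
  refine ge_of_tendsto (x := 𝓝[>] x) ((tendsto_id.mono_left nhdsWithin_le_nhds).add_const _) ?_
  filter_upwards [hties, eventually_filter_le_eq (S'.alive t) (fun i => (1 - α) * S.y i t) x,
    self_mem_nhdsWithin] with z hz hfilter hxz
  rw [← hfilter]
  refine (Finset.sum_le_sum_of_subset_of_nonneg (Finset.monotone_filter_right _ fun j _ hj =>
    lt_of_le_of_lt hj hxz) fun j _ _ => S.rem_nonneg j t).trans
    (hS.sum_rem_lt_le_of_notMem_tieLevels hα0 hα1 S' (hx.trans hxz) hz ht)

theorem card_alive_sdiff_le [DecidableEq J] (hS : S.IsAlgorithmSchedule α) (hα0 : 0 ≤ α)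
    (hα1 : α < 1) (S' : Schedule I) (ht : 0 ≤ t) :
    ((S.alive t \ S'.alive t).card : ℝ) ≤ (1 / (1 - α) + 1) * (S'.alive t).card + 1 := by
  have hα : 0 < 1 - α := sub_pos.2 hα1
  refine card_le_of_forall_sum_le_add (a := fun j => S.rem j t) (b := fun i => (1 - α) * S.y i t)
    (by positivity) (fun j hj => (S.mem_alive.1 (Finset.sdiff_subset hj)).2)
    (fun i _ => mul_nonneg hα.le (S.y_nonneg i t)) fun x hx => ?_
  rw [← Finset.mul_sum, ← mul_assoc, one_div_mul_cancel hα.ne', one_mul]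
  exact hS.sum_rem_alive_sdiff_le hα0 hα1 S' hx ht

/-- With a threshold `x` above all processing times, there is no unfinished job released before
`s`. -/
theorem alive_eq_empty (hS : S.IsAlgorithmSchedule α) {S' : Schedule I} (ht : 0 ≤ t)
    (hempty : S'.alive t = ∅) : S.alive t = ∅ := by
  classical
  obtain ⟨s, ⟨hs, hst⟩, hcleared, hbusy⟩ :=
    S.exists_clearedBelow_busyBelow α (∑ i, I.p i + 1) ht
  have hdone : ∀ j, I.r j < s → S.rem j s = 0 := fun j hj =>
    (hcleared j hj).resolve_right fun hle => by
      linarith [priority_le_rem (S := S) (α := α) j s, S.rem_le_p j s,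
        Finset.single_le_sum (fun i _ => (I.p_pos i).le) (Finset.mem_univ j)]
  have hdone' : ∀ j, I.r j < s → S.rem j t = 0 := fun j hj =>
    ((S.rem_anti j hst).trans_eq (hdone j hj)).antisymm (S.rem_nonneg j t)
  have hnew := S.sum_rem_le_of_sum_rate_eq_one S' hst
    fun u hu => hS.sum_rate_eq_one_of_busyBelow hs hbusy hu
  have hidle : ∑ j with I.r j < s, (S.y j t - S.y j s) = 0 := Finset.sum_eq_zero fun j hj => by
    have hj := (Finset.mem_filter.1 hj).2
    linarith [hdone j hj, hdone' j hj, S.y_add_rem j s, S.y_add_rem j t]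
  simp only [hidle, hempty, Finset.sdiff_empty, Finset.filter_empty, Finset.sum_empty,
    add_zero] at hnew
  refine Finset.eq_empty_of_forall_notMem fun j hj => ?_
  have hpos := (S.mem_alive.1 hj).2
  have hj' : j ∈ ({j ∈ S.alive t | s ≤ I.r j} : Finset J) :=
    Finset.mem_filter.2 ⟨hj, not_lt.1 fun hlt => hpos.ne' (hdone' j hlt)⟩
  linarith [Finset.single_le_sum (f := fun j => S.rem j t) (fun j _ => S.rem_nonneg j t) hj']

end IsAlgorithmSchedule

end Schedule

theorem mainTheorem3_general {J : Type*} [Fintype J] [DecidableEq J] (I : SchedInstance J)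
    (α : ℝ) (hα0 : 0 ≤ α) (hα1 : α < 1) (S : Schedule I) (hS : S.IsAlgorithmSchedule α)
    (S' : Schedule I) (t : ℝ) :
    ((S.alive t \ S'.alive t).card : ℝ) ≤ (2 + 1 / (1 - α)) * ((S'.alive t).card : ℝ) := by
  rcases lt_or_ge t 0 with ht | ht
  · have hempty : S.alive t = ∅ := Finset.eq_empty_of_forall_notMem fun j hj =>
      ht.not_ge ((I.r_nonneg j).trans (S.mem_alive.1 hj).1)
    rw [hempty, Finset.empty_sdiff, Finset.card_empty, Nat.cast_zero]
    have : 0 < 1 - α := sub_pos.2 hα1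
    positivity
  rcases (S'.alive t).eq_empty_or_nonempty with hO | hO
  · simp [hO, hS.alive_eq_empty ht hO]
  · have hcard : (1 : ℝ) ≤ (S'.alive t).card := by exact_mod_cast hO.card_pos
    linarith [hS.card_alive_sdiff_le hα0 hα1 S' ht]

theorem mainTheorem3 {J : Type*} [Fintype J] [DecidableEq J] (I : SchedInstance J)
    (α : ℝ) (hα0 : 0 ≤ α) (hα1 : α < 1)
    (S : Schedule I) (hS : S.IsAlgorithmSchedule α)
    (S' : Schedule I) (hS' : S'.IsOptimal) (t : ℝ) :
    ((S.alive t \ S'.alive t).card : ℝ) ≤ (3 + 2 / (1 - α)) * ((S'.alive t).card : ℝ) := by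
  have : 0 < 1 - α := sub_pos.2 hα1
  exact (mainTheorem3_general I α hα0 hα1 S hS S' t).trans (by gcongr <;> norm_num)
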